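/- Let $A:\mathbb R^n\to\mathbb R^m$ be linear, $y\in\mathbb R^m$, $F(x)=\tfrac12\|Ax-y\|^2$, and let $J:\mathbb R^n\to\mathbb R\cup\{+\infty\}$ be proper, lower semicontinuous and convex. For a point $x$ with $\partial J(x)\ne\emptyset$, let $T_x$ be the orthogonal complement of the linear subspace parallel to the affine hull of $\partial J(x)$. We say that $J$ is *partly smooth* at $x$ relative to a set $\mathcal M\ni x$ if $\mathcal M$ is a $C^2$-manifold around $x$ whose tangent space at $x$ is $T_x$, the restriction of $J$ to $\mathcal M$ is $C^2$ around $x$, and the set-valued map $\partial J$ is continuous (outer and inner semicontinuous) at $x$ relative to $\mathcal M$. Let $x^\star$ be a minimiser of $F+J$, write $T=T_{x^\star}$, and assume that $J$ is partly smooth at $x^\star$ relative to some set $\mathcal M$, that $$-\nabla F(x^\star)\in\operatorname{ri}\,\partial J(x^\star),$$ that $T\neq\{0\}$, and that $\ker A\cap T=\{0\}$. Let $\sigma_{\max}$ be the largest eigenvalue of $A^*A$, and let $\sigma_m$ and $\sigma_M$ be the smallest and the largest eigenvalue of $A_T^*A_T=P_TA^*AP_T$ regarded as an endomorphism of $T$,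 where $P_T$ is the orthogonal projector onto $T$. Let $(x_k)_{k\ge0}$ be generated from an arbitrary $x_0$ by the Forward--Backward scheme $$x_{k+1}=\operatorname{prox}_{\gamma_kJ}\big(x_k-\gamma_k\nabla F(x_k)\big),\qquad \operatorname{prox}_{\gamma J}(x)=\operatorname*{argmin}_z\ \tfrac1{2\gamma}\|z-x\|^2+J(z),$$ where $0<\underline\gamma\le\gamma_k\le\bar\gamma<2/\sigma_{\max}$ for all $k$, and suppose that $x_k\to x^\star$. Then there exists an integer $K>0$ such that the following hold for all $k\ge K$. 1. ($Q$-linear rate) If $\bar\gamma<2\sigma_m/\sigma_{\max}^2$, put $q(\gamma)=1-2\sigma_m\gamma+\sigma_{\max}^2\gamma^2$ and $\widetilde\rho=\sqrt{\max\{q(\underline\gamma),q(\bar\gamma)\}}$. Then $\widetilde\rho^{\,2}\in[0,1)$, and for every $\rho$ with $\widetilde\rho<\rho<1$, $$\|x_{k+1}-x^\star\|\le\rho\,\|x_k-x^\star\|.$$ 2. (Affine or linear manifold) If $J$ is partly smooth at $x^\star$ relative to $x^\star+T$, or relative to $T$, then $$\|x_{k+1}-x^\star\|\le\rho_k\,\|x_k-x^\star\|,\qquad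 \rho_k=\max\{|1-\gamma_k\sigma_m|,\ |1-\gamma_k\sigma_M|\}\in[0,1).$$ Moreover, if $\frac{2}{\sigma_m+\sigma_M}\le\bar\gamma$, then the function $\gamma\mapsto\max\{|1-\gamma\sigma_m|,|1-\gamma\sigma_M|\}$ attains its minimum at $\gamma=\frac{2}{\sigma_m+\sigma_M}$, with minimal value $$\rho^*=\frac{\varphi-1}{\varphi+1}=1-\frac{2}{\varphi+1},\qquad \varphi=\frac{\sigma_M}{\sigma_m},$$ where $\varphi$ is the condition number of $A_T^*A_T$ on $T$; in particular, if $\gamma_k=\frac{2}{\sigma_m+\sigma_M}$ for all $k$, then $\|x_{k+1}-x^\star\|\le\rho^*\,\|x_k-x^\star\|$. -/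

import Mathlib

open Set Filter Topology

noncomputable section

/-- The space `ℝⁿ` with its Euclidean norm and inner product. -/
abbrev Euc (n : ℕ) : Type := EuclideanSpace ℝ (Fin n)

/-- Proper, lower semicontinuous and convex functions `J : ℝⁿ → ℝ ∪ {+∞}`
(convexity is convexity of the epigraph). -/
structure IsProperLscConvex {n : ℕ} (J : Euc n → EReal) : Prop where
  ne_bot : ∀ x, J x ≠ ⊥
  exists_ne_top : ∃ x, J x ≠ ⊤
  lsc : LowerSemicontinuous J
  convex_epigraph : Convex ℝ {p : Euc n × ℝ | J p.1 ≤ (p.2 : EReal)}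

/-- The convex subdifferential `∂J(x)`. -/
def subdiff {n : ℕ} (J : Euc n → EReal) (x : Euc n) : Set (Euc n) :=
  {u | ∀ z, J x + ((inner ℝ u (z - x) : ℝ) : EReal) ≤ J z}

/-- The tangent model subspace: the orthogonal complement of the subspace parallel to the affine
hull of `∂J(x)`. -/
def modelSubspace {n : ℕ} (J : Euc n → EReal) (x : Euc n) : Submodule ℝ (Euc n) :=
  (vectorSpan ℝ (subdiff J x))ᗮ

/-- `h = 0` is a local `C²` equation of `M` around `x` with surjective derivative: near `x` the set
`M` is the zero set of `h`. A set `M` containing `x` is a `C²`-manifold around `x` iff it has such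
an equation, and then its tangent space at `x` is the kernel of the derivative of `h` at `x`. -/
structure IsLocalC2Equation {n p : ℕ} (M : Set (Euc n)) (x : Euc n) (h : Euc n → Euc p) : Prop where
  contDiffAt : ContDiffAt ℝ 2 h x
  surjective : Function.Surjective (fderiv ℝ h x)
  mem_iff : ∀ᶠ z in 𝓝 x, (z ∈ M ↔ h z = 0)

/-- `J` restricted to `M` is a (finite-valued) `C²` function around `x`. -/
def IsC2Along {n : ℕ} (J : Euc n → EReal) (M : Set (Euc n)) (x : Euc n) : Prop :=
  ∃ g : Euc n → ℝ, ContDiffAt ℝ 2 g x ∧ ∀ᶠ z in 𝓝[M] x, J z = (g z : EReal)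

/-- Continuity at `x` relative to `M` of a set-valued map: outer and inner semicontinuity in the
sense of Painlevé and Kuratowski. -/
structure SetValuedContinuousAt {n : ℕ} (S : Euc n → Set (Euc n)) (M : Set (Euc n)) (x : Euc n) :
    Prop where
  outer : ∀ u ∉ S x, ∃ W ∈ 𝓝 u, ∀ᶠ z in 𝓝[M] x, Disjoint (S z) W
  inner : ∀ u ∈ S x, ∀ W ∈ 𝓝 u, ∀ᶠ z in 𝓝[M] x, (S z ∩ W).Nonempty

/-- `J` is partly smooth at `x` relative to the set `M` (for `J` proper, lsc and convex). The field
`smooth_sharp` says that `M` is a `C²`-manifold around `x` whose tangent space at `x` is the model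
subspace. -/
structure IsPartlySmoothAt {n : ℕ} (J : Euc n → EReal) (x : Euc n) (M : Set (Euc n)) : Prop where
  subdiff_nonempty : (subdiff J x).Nonempty
  mem : x ∈ M
  smooth_sharp : ∃ (p : ℕ) (h : Euc n → Euc p), IsLocalC2Equation M x h ∧
    (fderiv ℝ h x).ker = modelSubspace J x
  smooth_along : IsC2Along J M x
  continuous : SetValuedContinuousAt (subdiff J) M x

/-- Partly smooth at `x` relative to the affine manifold `x + T_x`. -/
def IsPartlySmoothAffine {n : ℕ} (J : Euc n → EReal) (x : Euc n) : Prop :=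
  IsPartlySmoothAt J x (AffineSubspace.mk' x (modelSubspace J x))

/-- Partly smooth at `x` relative to the linear manifold `T_x`. -/
def IsPartlySmoothLinear {n : ℕ} (J : Euc n → EReal) (x : Euc n) : Prop :=
  IsPartlySmoothAt J x (modelSubspace J x)

/-- `p = prox_{γ J}(x)`, i.e. `p` minimises `z ↦ ‖z - x‖² / (2γ) + J z`. -/
def IsProx {n : ℕ} (γ : ℝ) (J : Euc n → EReal) (x p : Euc n) : Prop :=
  IsMinOn (fun z => ((1 / (2 * γ) * ‖z - x‖ ^ 2 : ℝ) : EReal) + J z) univ p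

/-- The quadratic function `F(x) = ½ ‖A x - y‖²`. -/
def quadLoss {n m : ℕ} (A : Euc n →ₗ[ℝ] Euc m) (y : Euc m) (x : Euc n) : ℝ :=
  1 / 2 * ‖A x - y‖ ^ 2

/-- `x` is a sequence of Forward-Backward iterates for `F + J` with step-sizes `γ`. -/
def IsForwardBackward {n : ℕ} (F : Euc n → ℝ) (J : Euc n → EReal) (γ : ℕ → ℝ)
    (x : ℕ → Euc n) : Prop :=
  ∀ k, IsProx (γ k) J (x k - γ k • gradient F (x k)) (x (k + 1))

/-- The set of (real) eigenvalues of a linear endomorphism. -/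
def eigenvalueSet {V : Type*} [AddCommGroup V] [Module ℝ V] (f : V →ₗ[ℝ] V) : Set ℝ :=
  {μ | Module.End.HasEigenvalue f μ}

/-- The operator `A* A` on `ℝⁿ`. -/
def gram {n m : ℕ} (A : Euc n →ₗ[ℝ] Euc m) : Euc n →ₗ[ℝ] Euc n :=
  LinearMap.adjoint A ∘ₗ A

/-- The operator `A_T* A_T` as an endomorphism of the subspace `T`, i.e. the restriction to `T` of
`P_T A* A P_T`. -/
def gramOn {n m : ℕ} (A : Euc n →ₗ[ℝ] Euc m) (T : Submodule ℝ (Euc n)) : T →ₗ[ℝ] T :=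
  LinearMap.adjoint (A.domRestrict T) ∘ₗ A.domRestrict T

/-- `q(γ) = 1 - 2 σ_m γ + σ_max² γ²`. -/
def qRate (σm σmax γ : ℝ) : ℝ := 1 - 2 * σm * γ + σmax ^ 2 * γ ^ 2

/-- `max {|1 - γ σ_m|, |1 - γ σ_M|}`. -/
def linRate (σm σM γ : ℝ) : ℝ := max |1 - γ * σm| |1 - γ * σM|

end

/-! Write G = A*A, and split displacements from x* along T and its orthogonal complement N.
Optimality of the prox puts a subgradient u at each new iterate z, and u tends to -∇F(x*).
Nondegeneracy gives a ball of radius ε in N around -∇F(x*) inside ∂J(x*).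

Identification: a normal offset d from the manifold would contradict monotonicity of ∂J, since inner
semicontinuity provides subgradients at nearby manifold points tilted by about ε along d/‖d‖.

Rate (`norm_forwardBackward_step_le`): with w = (I - γG)(x - x*), tilting the subgradient at x*
yields ‖z - x*‖² + γε‖b'‖ ≤ ⟨w, z - x*⟩, where b' is the normal part of z - x*. Once ‖w‖ ≤ γε, the
normal part of the right side is absorbed and only the tangential part of w matters. It consists of
the compression of I - γG to T, with norm at most `linRate`, and an off-diagonal term acting on the
normal part b of x - x*.

If the manifold is x* + T or T, then b = 0. In general b = o(‖x - x*‖). Since K must not depend on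
ρ, this error is absorbed by the gap between `linRate` and √max q, not by ρ. The gap closes only
when σm = σmax, and then the off-diagonal term vanishes as well (`exists_pos_linRate_add_le_sqrt`).
-/

/-! ### Subgradients, the proximal map and relative interiors -/

section Subdifferential

variable {n : ℕ} {J : Euc n → EReal}

lemma IsProperLscConvex.exists_real (hJ : IsProperLscConvex J) {x : Euc n} (hx : J x ≠ ⊤) :
    ∃ a : ℝ, J x = a :=
  ⟨_, (EReal.coe_toReal hx (hJ.ne_bot x)).symm⟩

lemma IsProperLscConvex.ne_top_of_mem_subdiff (hJ : IsProperLscConvex J) {x u : Euc n}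
    (hu : u ∈ subdiff J x) : J x ≠ ⊤ := by
  intro h
  obtain ⟨z, hz⟩ := hJ.exists_ne_top
  have := hu z
  rw [h, EReal.top_add_coe, top_le_iff] at this
  exact hz this

/-- The subdifferential is a monotone operator. -/
lemma IsProperLscConvex.subdiff_monotone (hJ : IsProperLscConvex J) {x z u v : Euc n}
    (hu : u ∈ subdiff J x) (hv : v ∈ subdiff J z) : 0 ≤ inner ℝ (u - v) (x - z) := by
  obtain ⟨a, ha⟩ := hJ.exists_real (hJ.ne_top_of_mem_subdiff hu)
  obtain ⟨b, hb⟩ := hJ.exists_real (hJ.ne_top_of_mem_subdiff hv)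
  have h1 := hu z
  have h2 := hv x
  rw [ha, hb] at h1 h2
  norm_cast at h1 h2
  have : (inner ℝ u (z - x) : ℝ) = - inner ℝ u (x - z) := by rw [← inner_neg_right, neg_sub]
  rw [inner_sub_left]
  linarith

/-- The optimality condition of the proximal operator. -/
lemma IsProx.mem_subdiff (hJ : IsProperLscConvex J) {γ : ℝ} (hγ : 0 < γ) {p q : Euc n}
    (h : IsProx γ J p q) : γ⁻¹ • (p - q) ∈ subdiff J q := by
  have hmin : ∀ z, ((1 / (2 * γ) * ‖q - p‖ ^ 2 : ℝ) : EReal) + J q ≤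
      ((1 / (2 * γ) * ‖z - p‖ ^ 2 : ℝ) : EReal) + J z := fun z => h (mem_univ z)
  have hq : J q ≠ ⊤ := by
    intro hq
    obtain ⟨z, hz⟩ := hJ.exists_ne_top
    obtain ⟨b, hb⟩ := hJ.exists_real hz
    have := hmin z
    rw [hq, hb, EReal.coe_add_top, top_le_iff, ← EReal.coe_add] at this
    exact EReal.coe_ne_top _ this
  obtain ⟨a, ha⟩ := hJ.exists_real hq
  intro z
  by_cases hz : J z = ⊤
  · rw [hz]; exact le_top
  obtain ⟨b, hb⟩ := hJ.exists_real hz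
  rw [ha, hb, ← EReal.coe_add, EReal.coe_le_coe_iff]
  set s : ℝ := inner ℝ (p - q) (z - q) with hs
  set c : ℝ := γ⁻¹ / 2 * ‖z - q‖ ^ 2 with hc
  have hc0 : 0 ≤ c := by positivity
  -- Compare q with the point (1 - t)q + tz of the segment to z and divide by t.
  have key : ∀ t : ℝ, 0 < t → t ≤ 1 → a + γ⁻¹ * s - b ≤ t * c := by
    intro t ht ht1
    have hw : J ((1 - t) • q + t • z) ≤ (((1 - t) * a + t * b : ℝ) : EReal) := by
      have := hJ.convex_epigraph (x := (q, a)) (y := (z, b)) (by simp [ha]) (by simp [hb])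
        (sub_nonneg.2 ht1) ht.le (by ring)
      simpa using this
    have h1 := (hmin ((1 - t) • q + t • z)).trans (add_le_add_right hw _)
    rw [ha] at h1
    norm_cast at h1
    have h2 : ‖(1 - t) • q + t • z - p‖ ^ 2 = ‖q - p‖ ^ 2 - 2 * t * s + t ^ 2 * ‖z - q‖ ^ 2 := by
      have : (1 - t) • q + t • z - p = t • (z - q) - (p - q) := by module
      rw [this, norm_sub_sq_real, norm_smul, inner_smul_left, real_inner_comm, ← hs, mul_pow,
        norm_sub_rev p q]
      simp
      ring
    rw [h2] at h1
    have h3 : 1 / (2 * γ) = γ⁻¹ / 2 := by field_simp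
    rw [h3] at h1
    have : t * (a + γ⁻¹ * s - b) ≤ t * (t * c) := by rw [hc]; linarith
    exact le_of_mul_le_mul_left this ht
  rw [inner_smul_left]
  simp only [conj_trivial]
  by_contra hcon
  have hD : 0 < a + γ⁻¹ * s - b := by linarith
  set D := a + γ⁻¹ * s - b with hDdef
  -- This explicit t replaces the limit t → 0: it turns D ≤ tc into D² ≤ 0.
  have := key (D / (D + c)) (by positivity) ((div_le_one (by positivity)).2 (by linarith))
  rw [div_mul_eq_mul_div, le_div_iff₀ (by positivity)] at this
  nlinarith

lemma exists_pos_forall_add_mem_of_mem_intrinsicInterior {E : Type*} [NormedAddCommGroup E]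
    [NormedSpace ℝ E] {S : Set E} {u : E} (hu : u ∈ intrinsicInterior ℝ S) :
    ∃ ε > 0, ∀ w ∈ vectorSpan ℝ S, ‖w‖ ≤ ε → u + w ∈ S := by
  obtain ⟨y, hy, rfl⟩ := mem_intrinsicInterior.1 hu
  obtain ⟨ε, hε, hball⟩ := Metric.mem_nhds_iff.1 (mem_interior_iff_mem_nhds.1 hy)
  refine ⟨ε / 2, by positivity, fun w hw hwn => ?_⟩
  have hmem : (y : E) + w ∈ affineSpan ℝ S := by
    have := AffineSubspace.vadd_mem_of_mem_direction (s := affineSpan ℝ S)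
      (by rwa [direction_affineSpan]) y.2
    rwa [vadd_eq_add, add_comm] at this
  have : (⟨(y : E) + w, hmem⟩ : affineSpan ℝ S) ∈ Metric.ball y ε := by
    rw [Metric.mem_ball, Subtype.dist_eq, dist_eq_norm]
    simp only [add_sub_cancel_left]
    linarith
  exact hball this

end Subdifferential

/-! ### Spectral bounds for symmetric operators -/

section Spectral

variable {V : Type*} [NormedAddCommGroup V] [InnerProductSpace ℝ V] [FiniteDimensional ℝ V]
  {f : V →ₗ[ℝ] V}

lemma LinearMap.IsSymmetric.norm_smul_sub_smul_le (hf : f.IsSymmetric) {c g r : ℝ} (hr : 0 ≤ r)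
    (h : ∀ μ ∈ eigenvalueSet f, |c - g * μ| ≤ r) (v : V) : ‖c • v - g • f v‖ ≤ r * ‖v‖ := by
  let b := hf.eigenvectorBasis rfl
  rw [← b.repr.norm_map, ← b.repr.norm_map v, ← sq_le_sq₀ (norm_nonneg _) (by positivity),
    mul_pow, EuclideanSpace.real_norm_sq_eq, EuclideanSpace.real_norm_sq_eq, Finset.mul_sum]
  refine Finset.sum_le_sum fun i _ => ?_
  have hi : b.repr (c • v - g • f v) i = (c - g * hf.eigenvalues rfl i) * b.repr v i := by
    have := hf.eigenvectorBasis_apply_self_apply rfl v i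
    simp only [map_sub, map_smul, PiLp.sub_apply, PiLp.smul_apply, smul_eq_mul]
    rw [this]
    simp [b]
    ring
  rw [hi, mul_pow]
  have := h _ (hf.hasEigenvalue_eigenvalues rfl i)
  refine mul_le_mul_of_nonneg_right ?_ (sq_nonneg _)
  rw [← sq_abs]
  exact pow_le_pow_left₀ (abs_nonneg _) this 2

lemma LinearMap.IsSymmetric.mul_norm_sq_le_inner (hf : f.IsSymmetric) {a : ℝ}
    (h : ∀ μ ∈ eigenvalueSet f, a ≤ μ) (v : V) : a * ‖v‖ ^ 2 ≤ inner ℝ (f v) v := by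
  let b := hf.eigenvectorBasis rfl
  rw [← b.repr.norm_map v, ← b.repr.inner_map_map, EuclideanSpace.real_norm_sq_eq, Finset.mul_sum,
    PiLp.inner_apply]
  refine Finset.sum_le_sum fun i _ => ?_
  have hi := hf.eigenvectorBasis_apply_self_apply rfl v i
  have h1 : a ≤ hf.eigenvalues rfl i := h _ (hf.hasEigenvalue_eigenvalues rfl i)
  simp only [b]
  rw [hi]
  simp only [RCLike.inner_apply, conj_trivial, RCLike.ofReal_real_eq_id, _root_.id]
  nlinarith [mul_le_mul_of_nonneg_right h1 (sq_nonneg ((hf.eigenvectorBasis rfl).repr v i))]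

end Spectral

/-! ### Finite identification of the manifold -/

section Identification

variable {n : ℕ} {J : Euc n → EReal}

lemma exists_pos_forall_add_mem_subdiff {x u : Euc n}
    (hu : u ∈ intrinsicInterior ℝ (subdiff J x)) :
    ∃ ε > 0, ∀ w ∈ (modelSubspace J x)ᗮ, ‖w‖ ≤ ε → u + w ∈ subdiff J x := by
  simpa [modelSubspace] using exists_pos_forall_add_mem_of_mem_intrinsicInterior hu

/-- Inner semicontinuity is uniform on compact subsets of the limiting value. -/
lemma SetValuedContinuousAt.eventually_forall_exists_dist_lt {S : Euc n → Set (Euc n)}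
    {M : Set (Euc n)} {x : Euc n} (h : SetValuedContinuousAt S M x) {K : Set (Euc n)}
    (hK : IsCompact K) (hKS : K ⊆ S x) {ε : ℝ} (hε : 0 < ε) :
    ∀ᶠ z in 𝓝[M] x, ∀ u ∈ K, ∃ v ∈ S z, dist v u < ε := by
  obtain ⟨t, htK, htf, hcov⟩ := hK.finite_cover_balls (half_pos hε)
  have hev : ∀ᶠ z in 𝓝[M] x, ∀ c ∈ t, (S z ∩ Metric.ball c (ε / 2)).Nonempty :=
    (eventually_all_finite htf).2 fun c hc =>
      h.inner c (hKS (htK hc)) _ (Metric.ball_mem_nhds c (half_pos hε))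
  filter_upwards [hev] with z hz u hu
  obtain ⟨c, hc, huc⟩ := mem_iUnion₂.1 (hcov hu)
  obtain ⟨v, hv, hvc⟩ := hz c hc
  refine ⟨v, hv, ?_⟩
  have := dist_triangle_right v u c
  rw [Metric.mem_ball] at huc hvc
  linarith

/-- Every point near `x` differs by a vector normal to the tangent space at `x` from a point of the
manifold near `x`. -/
lemma IsLocalC2Equation.eventually_exists_sub_mem_orthogonal {p : ℕ} {M : Set (Euc n)} {x : Euc n}
    {h : Euc n → Euc p} (hh : IsLocalC2Equation M x h) (hxM : x ∈ M) {P : Euc n → Prop}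
    (hP : ∀ᶠ z in 𝓝[M] x, P z) :
    ∀ᶠ w in 𝓝 x, ∃ z ∈ M, P z ∧ w - z ∈ ((fderiv ℝ h x).ker)ᗮ := by
  set T := (fderiv ℝ h x).ker
  have hhx : h x = 0 := hh.mem_iff.self_of_nhds.1 hxM
  -- The derivative of z ↦ (h z, P_T z) is onto, so this map is open at x; its values near x
  -- therefore include (0, P_T w) for every w close to x.
  have hd : HasStrictFDerivAt (fun z => (h z, T.orthogonalProjectionOnto z))
      ((fderiv ℝ h x).prod T.orthogonalProjectionOnto) x :=
    (hh.contDiffAt.hasStrictFDerivAt (by norm_num)).prodMk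
      T.orthogonalProjectionOnto.hasStrictFDerivAt
  have hsurj : ((fderiv ℝ h x).prod T.orthogonalProjectionOnto).range = ⊤ := by
    rw [LinearMap.range_eq_top]
    rintro ⟨a, t⟩
    obtain ⟨v, hv⟩ := hh.surjective a
    set r : T := t - T.orthogonalProjectionOnto v
    have hr : fderiv ℝ h x (r : Euc n) = 0 := r.2
    refine ⟨v + r, Prod.ext ?_ ?_⟩
    · change fderiv ℝ h x (v + r) = a
      rw [map_add, hr, hv, add_zero]
    · change T.orthogonalProjectionOnto (v + r) = t
      rw [map_add, Submodule.orthogonalProjectionOnto_mem_subspace_eq_self, add_sub_cancel]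
  have hmap := hd.map_nhds_eq_of_surj hsurj
  have hU := image_mem_map (m := fun z => (h z, T.orthogonalProjectionOnto z))
    ((eventually_nhdsWithin_iff.1 hP).and hh.mem_iff)
  rw [hmap, hhx] at hU
  have hcont : Tendsto (fun w : Euc n => ((0 : Euc p), T.orthogonalProjectionOnto w)) (𝓝 x)
      (𝓝 (0, T.orthogonalProjectionOnto x)) :=
    (Continuous.prodMk continuous_const T.orthogonalProjectionOnto.continuous).tendsto x
  filter_upwards [hcont hU] with w ⟨z, ⟨hz1, hz2⟩, hz⟩
  obtain ⟨hz3, hz4⟩ := Prod.ext_iff.1 hz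
  have hzM : z ∈ M := hz2.2 hz3
  refine ⟨z, hzM, hz1 hzM, ?_⟩
  rw [← Submodule.orthogonalProjectionOnto_eq_zero_iff, map_sub, sub_eq_zero]
  exact hz4.symm

/-- Finite identification of the active manifold. -/
lemma IsPartlySmoothAt.eventually_mem (hJ : IsProperLscConvex J) {M : Set (Euc n)}
    {xs us : Euc n} (hM : IsPartlySmoothAt J xs M)
    (hus : us ∈ intrinsicInterior ℝ (subdiff J xs)) {x u : ℕ → Euc n}
    (hx : Tendsto x atTop (𝓝 xs)) (hu : Tendsto u atTop (𝓝 us))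
    (hsub : ∀ᶠ k in atTop, u k ∈ subdiff J (x k)) : ∀ᶠ k in atTop, x k ∈ M := by
  obtain ⟨ε, hε, hball⟩ := exists_pos_forall_add_mem_subdiff hus
  obtain ⟨p, h, hh, hker⟩ := hM.smooth_sharp
  set N := (modelSubspace J xs)ᗮ with hN
  -- The direction of the normal offset is not known in advance, so inner semicontinuity is needed
  -- uniformly over the whole ball of tilts.
  have hK : IsCompact ((fun w => us + w) '' (Metric.closedBall 0 ε ∩ (N : Set (Euc n)))) :=
    ((isCompact_closedBall _ _).inter_right N.closed_of_finiteDimensional).image (by fun_prop)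
  have hKS : (fun w => us + w) '' (Metric.closedBall 0 ε ∩ (N : Set (Euc n))) ⊆ subdiff J xs := by
    rintro _ ⟨w, ⟨hw1, hw2⟩, rfl⟩
    exact hball w hw2 (by simpa using hw1)
  have hP := hM.continuous.eventually_forall_exists_dist_lt hK hKS (half_pos hε)
  have hev := hh.eventually_exists_sub_mem_orthogonal hM.mem hP
  rw [hker] at hev
  filter_upwards [hx.eventually hev, hsub, hu.eventually (Metric.ball_mem_nhds us (half_pos hε))]
    with k ⟨z, hzM, hz, hzN⟩ hk hku
  by_cases hd : x k - z = 0
  · rwa [sub_eq_zero.1 hd]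
  exfalso
  set d := x k - z with hddef
  have hd0 : 0 < ‖d‖ := norm_pos_iff.2 hd
  have hw : ‖(ε / ‖d‖) • d‖ = ε := by
    rw [norm_smul, Real.norm_of_nonneg (by positivity), div_mul_cancel₀ _ hd0.ne']
  -- The tilt contributes -ε‖d‖ to ⟨u k - v, d⟩, while the two errors, each below ε/2, cannot
  -- compensate for it.
  obtain ⟨v, hv, hvd⟩ := hz (us + (ε / ‖d‖) • d)
    ⟨(ε / ‖d‖) • d, ⟨by simpa using hw.le, N.smul_mem _ hzN⟩, rfl⟩
  have hmono := hJ.subdiff_monotone hk hv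
  rw [← hddef] at hmono
  have e : u k - v = (u k - us) - (v - (us + (ε / ‖d‖) • d)) - (ε / ‖d‖) • d := by abel
  rw [e, inner_sub_left, inner_sub_left, inner_smul_left, real_inner_self_eq_norm_sq] at hmono
  have h1 := real_inner_le_norm (u k - us) d
  have h2 := neg_le_of_abs_le (abs_real_inner_le_norm (v - (us + (ε / ‖d‖) • d)) d)
  rw [dist_eq_norm] at hku hvd
  have h3 : (ε / ‖d‖) * ‖d‖ ^ 2 = ε * ‖d‖ := by field_simp
  simp only [conj_trivial] at hmono
  rw [h3] at hmono
  nlinarith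

end Identification

/-! ### Scalar estimates for the two rates -/

section Rates

lemma linRate_nonneg (σm σM g : ℝ) : 0 ≤ linRate σm σM g :=
  (abs_nonneg _).trans (le_max_left _ _)

lemma abs_one_sub_mul_le_linRate {σm σM g μ : ℝ} (hg : 0 ≤ g) (h1 : σm ≤ μ) (h2 : μ ≤ σM) :
    |1 - g * μ| ≤ linRate σm σM g := by
  have h3 := mul_le_mul_of_nonneg_left h1 hg
  have h4 := mul_le_mul_of_nonneg_left h2 hg
  rw [linRate, le_max_iff]
  rcases le_total 0 (1 - g * μ) with h | h
  · exact Or.inl (by rw [abs_of_nonneg h]; exact le_trans (by linarith) (le_abs_self _))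
  · exact Or.inr (by rw [abs_of_nonpos h]; exact le_trans (by linarith) (neg_le_abs _))

lemma linRate_lt_one {σm σM g : ℝ} (hg : 0 < g) (hm : 0 < σm) (h : σm ≤ σM) (hM : g * σM < 2) :
    linRate σm σM g < 1 := by
  have h1 := mul_pos hg hm
  have h2 := mul_le_mul_of_nonneg_left h hg.le
  rw [linRate, max_lt_iff, abs_lt, abs_lt]
  refine ⟨⟨?_, ?_⟩, ?_, ?_⟩ <;> linarith

lemma linRate_optimal {σm σM : ℝ} (hm : 0 < σm) (h : σm ≤ σM) :
    linRate σm σM (2 / (σm + σM)) = (σM - σm) / (σm + σM) := by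
  have hs : 0 < σm + σM := by linarith
  have h1 : 1 - 2 / (σm + σM) * σm = (σM - σm) / (σm + σM) := by field_simp; ring
  have h2 : 1 - 2 / (σm + σM) * σM = -((σM - σm) / (σm + σM)) := by field_simp; ring
  have h3 : 0 ≤ (σM - σm) / (σm + σM) := div_nonneg (by linarith) hs.le
  rw [linRate, h1, h2, abs_neg, max_self, abs_of_nonneg h3]

lemma linRate_optimal_eq {σm σM : ℝ} (hm : 0 < σm) (h : σm ≤ σM) :
    linRate σm σM (2 / (σm + σM)) = (σM / σm - 1) / (σM / σm + 1) := by
  have hM : 0 < σM := hm.trans_le h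
  have : σM / σm + 1 ≠ 0 := by positivity
  rw [linRate_optimal hm h]
  field_simp
  ring

/-- Weighting 1 - gσm by σM and gσM - 1 by σm and adding cancels g, leaving σM - σm. -/
lemma linRate_optimal_le {σm σM : ℝ} (hm : 0 < σm) (h : σm ≤ σM) (g : ℝ) :
    linRate σm σM (2 / (σm + σM)) ≤ linRate σm σM g := by
  rw [linRate_optimal hm h, div_le_iff₀ (by linarith)]
  have h1 : 1 - g * σm ≤ linRate σm σM g := (le_abs_self _).trans (le_max_left _ _)
  have h2 : -(1 - g * σM) ≤ linRate σm σM g := (neg_le_abs _).trans (le_max_right _ _)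
  nlinarith [mul_le_mul_of_nonneg_right h1 (hm.le.trans h), mul_le_mul_of_nonneg_right h2 hm.le]

/-- Convexity of q: a larger interior value would make the secant slope positive on the left and
negative on the right. -/
lemma qRate_le_max {σm σmax lo hi g : ℝ} (h1 : lo ≤ g) (h2 : g ≤ hi) :
    qRate σm σmax g ≤ max (qRate σm σmax lo) (qRate σm σmax hi) := by
  by_contra hcon
  obtain ⟨h3, h4⟩ := max_lt_iff.1 (not_le.1 hcon)
  simp only [qRate] at h3 h4
  have h5 : 0 < (g - lo) * (σmax ^ 2 * (g + lo) - 2 * σm) := by linarith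
  have h6 : 0 < (hi - g) * (2 * σm - σmax ^ 2 * (g + hi)) := by linarith
  have h7 := pos_of_mul_pos_right h5 (sub_nonneg.2 h1)
  have h8 := pos_of_mul_pos_right h6 (sub_nonneg.2 h2)
  nlinarith [mul_le_mul_of_nonneg_left (h1.trans h2) (sq_nonneg σmax)]

lemma qRate_nonneg {σm σmax g : ℝ} (hm : 0 ≤ σm) (h : σm ≤ σmax) : 0 ≤ qRate σm σmax g := by
  have : σm ^ 2 ≤ σmax ^ 2 := pow_le_pow_left₀ hm h 2
  rw [qRate]
  nlinarith [sq_nonneg (1 - g * σm), mul_le_mul_of_nonneg_right this (sq_nonneg g)]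

lemma qRate_lt_one {σm σmax g : ℝ} (hg : 0 < g) (hmax : 0 < σmax) (h : g < 2 * σm / σmax ^ 2) :
    qRate σm σmax g < 1 := by
  rw [lt_div_iff₀ (by positivity)] at h
  rw [qRate]
  nlinarith [mul_lt_mul_of_pos_left h hg]

/-- The squared linear rate is below `q` by a margin that is uniform in the step size. -/
lemma linRate_sq_le_qRate_sub {σm σM σmax lo g : ℝ} (hm : 0 < σm) (h1 : σm ≤ σM)
    (h2 : σM ≤ σmax) (hlo : 0 < lo) (hg : lo ≤ g) :
    linRate σm σM g ^ 2 ≤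
      qRate σm σmax g - min (2 * lo) (lo ^ 2 * (σmax + σm)) * (σmax - σm) := by
  set η := min (2 * lo) (lo ^ 2 * (σmax + σm)) with hη
  have e1 : η ≤ 2 * g := (min_le_left _ _).trans (by linarith)
  have hsq : lo ^ 2 ≤ g ^ 2 := pow_le_pow_left₀ hlo.le hg 2
  have e2 : η ≤ g ^ 2 * (σmax + σm) :=
    (min_le_right _ _).trans (mul_le_mul_of_nonneg_right hsq (by linarith))
  have e3 : η ≤ g ^ 2 * (σmax + σM) :=
    e2.trans (mul_le_mul_of_nonneg_left (by linarith) (sq_nonneg g))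
  -- The two gaps are g²(σmax² - σm²) and 2g(σM - σm) + g²(σmax² - σM²); η bounds every coefficient
  -- of the differences of eigenvalues from below.
  rcases max_choice |1 - g * σm| |1 - g * σM| with h | h <;> rw [linRate, h, sq_abs, qRate]
  · nlinarith [mul_le_mul_of_nonneg_right e2 (sub_nonneg.2 (h1.trans h2))]
  · nlinarith [mul_le_mul_of_nonneg_right e1 (sub_nonneg.2 h1),
      mul_le_mul_of_nonneg_right e3 (sub_nonneg.2 h2)]

/-- Here δ is the tolerated ratio of normal displacement to total displacement, uniform over the
admissible step sizes. -/
lemma exists_pos_linRate_add_le_sqrt {σm σM σmax lo hi : ℝ} (hm : 0 < σm) (h1 : σm ≤ σM)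
    (h2 : σM ≤ σmax) (hlo : 0 < lo) :
    ∃ δ > 0, ∀ g, lo ≤ g → g ≤ hi →
      linRate σm σM g + g * √(2 * σmax * (σmax - σm)) * δ ≤
        √(max (qRate σm σmax lo) (qRate σm σmax hi)) := by
  set R := max (qRate σm σmax lo) (qRate σm σmax hi)
  set c := min (2 * lo) (lo ^ 2 * (σmax + σm)) * (σmax - σm) with hc
  have hrate : ∀ g, lo ≤ g → g ≤ hi → linRate σm σM g ≤ √(R - c) := fun g hg1 hg2 =>
    Real.le_sqrt_of_sq_le ((linRate_sq_le_qRate_sub hm h1 h2 hlo hg1).trans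
      (sub_le_sub_right (qRate_le_max hg1 hg2) _))
  rcases (h1.trans h2).eq_or_lt with heq | hlt
  -- With σm = σmax both the margin c and the coefficient of δ are zero, so any δ serves.
  · refine ⟨1, one_pos, fun g hg1 hg2 => ?_⟩
    simpa [hc, heq] using hrate g hg1 hg2
  have hcpos : 0 < c := mul_pos (lt_min (by positivity) (mul_pos (by positivity) (by linarith)))
    (sub_pos.2 hlt)
  rcases lt_or_ge hi lo with hlh | hlh
  · exact ⟨1, one_pos, fun g hg1 hg2 => absurd (hg1.trans hg2) (not_le.2 hlh)⟩
  have hR : 0 < R := by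
    have := (sq_nonneg _).trans ((linRate_sq_le_qRate_sub hm h1 h2 hlo le_rfl).trans
      (sub_le_sub_right (qRate_le_max le_rfl hlh) _))
    linarith
  have hgap : √(R - c) < √R := Real.sqrt_lt_sqrt_iff_of_pos hR |>.2 (by linarith)
  set C := √(2 * σmax * (σmax - σm))
  have hC : 0 ≤ C := Real.sqrt_nonneg _
  have hhi : 0 < hi := hlo.trans_le hlh
  have hden : 0 < hi * C + 1 := by positivity
  -- Chosen so that gCδ stays below the gap √R - √(R - c) for all g ≤ hi.
  refine ⟨(√R - √(R - c)) / (hi * C + 1), div_pos (sub_pos.2 hgap) hden, fun g hg1 hg2 => ?_⟩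
  have : g * C * ((√R - √(R - c)) / (hi * C + 1)) ≤ √R - √(R - c) := by
    rw [mul_div_assoc', div_le_iff₀ hden, mul_comm]
    refine mul_le_mul_of_nonneg_left ?_ (sub_pos.2 hgap).le
    nlinarith [mul_le_mul_of_nonneg_right hg2 hC]
  linarith [hrate g hg1 hg2]

end Rates

/-! ### The Gram operator and its blocks relative to T -/

section Gram

variable {n m : ℕ} (A : Euc n →ₗ[ℝ] Euc m)

lemma inner_gram (v w : Euc n) : inner ℝ (gram A v) w = (inner ℝ (A v) (A w) : ℝ) := by
  rw [gram, LinearMap.comp_apply, LinearMap.adjoint_inner_left]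

lemma isSymmetric_gram : (gram A).IsSymmetric := fun v w => by
  rw [real_inner_comm (gram A w) v, inner_gram, inner_gram, real_inner_comm]

lemma inner_gramOn (T : Submodule ℝ (Euc n)) (v w : T) :
    inner ℝ (gramOn A T v) w = (inner ℝ (A v) (A w) : ℝ) := by
  rw [gramOn, LinearMap.comp_apply, LinearMap.adjoint_inner_left]
  rfl

lemma isSymmetric_gramOn (T : Submodule ℝ (Euc n)) : (gramOn A T).IsSymmetric := fun v w => by
  rw [real_inner_comm (gramOn A T w) v, inner_gramOn, inner_gramOn, real_inner_comm]

lemma nonneg_of_mem_eigenvalueSet_gram {μ : ℝ} (h : μ ∈ eigenvalueSet (gram A)) : 0 ≤ μ :=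
  eigenvalue_nonneg_of_nonneg h fun v => by
    rw [RCLike.re_to_real, real_inner_comm, inner_gram]
    exact real_inner_self_nonneg

variable {A}

lemma norm_gram_le {σmax : ℝ} (h : IsGreatest (eigenvalueSet (gram A)) σmax) (v : Euc n) :
    ‖gram A v‖ ≤ σmax * ‖v‖ := by
  have := (isSymmetric_gram A).norm_smul_sub_smul_le (c := 0) (g := 1)
    (nonneg_of_mem_eigenvalueSet_gram A h.1) (fun μ hμ => by
      rw [zero_sub, one_mul, abs_neg, abs_of_nonneg (nonneg_of_mem_eigenvalueSet_gram A hμ)]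
      exact h.2 hμ) v
  simpa using this

lemma mul_norm_sq_le_inner_gram {T : Submodule ℝ (Euc n)} {σm : ℝ}
    (h : IsLeast (eigenvalueSet (gramOn A T)) σm) {t : Euc n} (ht : t ∈ T) :
    σm * ‖t‖ ^ 2 ≤ inner ℝ (gram A t) t := by
  have := (isSymmetric_gramOn A T).mul_norm_sq_le_inner (fun μ hμ => h.2 hμ) ⟨t, ht⟩
  rw [inner_gramOn] at this
  rwa [inner_gram]

lemma exists_norm_map_sq_eq_of_mem_eigenvalueSet_gramOn {T : Submodule ℝ (Euc n)} {μ : ℝ}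
    (h : μ ∈ eigenvalueSet (gramOn A T)) : ∃ t ∈ T, t ≠ 0 ∧ ‖A t‖ ^ 2 = μ * ‖t‖ ^ 2 := by
  obtain ⟨t, ht⟩ := Module.End.HasEigenvalue.exists_hasEigenvector h
  refine ⟨t, t.2, fun h0 => ht.2 (Subtype.ext h0), ?_⟩
  have := inner_gramOn A T t t
  rw [ht.apply_eq_smul, inner_smul_left, real_inner_self_eq_norm_sq,
    real_inner_self_eq_norm_sq] at this
  simpa using this.symm

lemma pos_of_mem_eigenvalueSet_gramOn {T : Submodule ℝ (Euc n)}
    (hker : LinearMap.ker A ⊓ T = ⊥) {μ : ℝ} (h : μ ∈ eigenvalueSet (gramOn A T)) : 0 < μ := by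
  obtain ⟨t, htT, ht0, ht⟩ := exists_norm_map_sq_eq_of_mem_eigenvalueSet_gramOn h
  have hA : A t ≠ 0 := fun hA => ht0 <| by
    have : t ∈ LinearMap.ker A ⊓ T := ⟨hA, htT⟩
    rwa [hker, Submodule.mem_bot] at this
  have h1 : 0 < ‖A t‖ ^ 2 := by positivity
  have h2 : 0 < ‖t‖ ^ 2 := by positivity
  rw [ht] at h1
  exact pos_of_mul_pos_left h1 h2.le

lemma le_of_mem_eigenvalueSet_gramOn {T : Submodule ℝ (Euc n)} {σmax μ : ℝ}
    (hmax : IsGreatest (eigenvalueSet (gram A)) σmax) (h : μ ∈ eigenvalueSet (gramOn A T)) :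
    μ ≤ σmax := by
  obtain ⟨t, -, ht0, ht⟩ := exists_norm_map_sq_eq_of_mem_eigenvalueSet_gramOn h
  have h2 : 0 < ‖t‖ ^ 2 := by positivity
  refine le_of_mul_le_mul_right ?_ h2
  rw [← ht, ← real_inner_self_eq_norm_sq, ← inner_gram]
  calc _ ≤ ‖gram A t‖ * ‖t‖ := real_inner_le_norm _ _
    _ ≤ σmax * ‖t‖ * ‖t‖ := mul_le_mul_of_nonneg_right (norm_gram_le hmax t) (norm_nonneg _)
    _ = _ := by ring

lemma inner_sub_smul_gram_le {T : Submodule ℝ (Euc n)} {σm σM g : ℝ} (hg : 0 ≤ g)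
    (hm : IsLeast (eigenvalueSet (gramOn A T)) σm)
    (hM : IsGreatest (eigenvalueSet (gramOn A T)) σM) {a t : Euc n} (ha : a ∈ T) (ht : t ∈ T) :
    inner ℝ (a - g • gram A a) t ≤ linRate σm σM g * ‖a‖ * ‖t‖ := by
  have h1 := (isSymmetric_gramOn A T).norm_smul_sub_smul_le (c := 1) (g := g)
    (linRate_nonneg σm σM g)
    (fun μ hμ => abs_one_sub_mul_le_linRate hg (hm.2 hμ) (hM.2 hμ)) ⟨a, ha⟩
  have h2 : (inner ℝ (a - g • gram A a) t : ℝ) =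
      inner ℝ ((1 : ℝ) • (⟨a, ha⟩ : T) - g • gramOn A T ⟨a, ha⟩) (⟨t, ht⟩ : T) := by
    have h3 := inner_gramOn A T ⟨a, ha⟩ ⟨t, ht⟩
    rw [Submodule.coe_inner] at h3
    rw [one_smul, Submodule.coe_inner, Submodule.coe_sub, Submodule.coe_smul, inner_sub_left,
      inner_sub_left, inner_smul_left, inner_smul_left, h3, inner_gram]
  rw [h2]
  exact (real_inner_le_norm _ _).trans (mul_le_mul_of_nonneg_right h1 (norm_nonneg _))

/-- The off-diagonal block of the Gram operator is small when the spectrum on `T` is close to the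
largest eigenvalue. -/
lemma abs_inner_gram_orthogonal_le {T : Submodule ℝ (Euc n)} {σm σmax : ℝ}
    (hmax : IsGreatest (eigenvalueSet (gram A)) σmax)
    (hm : IsLeast (eigenvalueSet (gramOn A T)) σm) {b t : Euc n} (hb : b ∈ Tᗮ) (ht : t ∈ T) :
    |inner ℝ (gram A b) t| ≤ √(2 * σmax * (σmax - σm)) * ‖b‖ * ‖t‖ := by
  have hσ : 0 ≤ σmax := nonneg_of_mem_eigenvalueSet_gram A hmax.1
  -- Subtracting σmax • t is free because b is orthogonal to t; the remainder is small when σm is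
  -- near σmax.
  have h1 : (inner ℝ (gram A b) t : ℝ) = inner ℝ b (gram A t - σmax • t) := by
    rw [inner_sub_right, inner_smul_right, Submodule.inner_left_of_mem_orthogonal ht hb, mul_zero,
      sub_zero]
    exact isSymmetric_gram A b t
  have h2 : ‖gram A t - σmax • t‖ ≤ √(2 * σmax * (σmax - σm)) * ‖t‖ := by
    rw [← Real.sqrt_sq (norm_nonneg t), ← Real.sqrt_mul' _ (sq_nonneg _)]
    refine Real.le_sqrt_of_sq_le ?_
    rw [norm_sub_sq_real, inner_smul_right, norm_smul, Real.norm_of_nonneg hσ]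
    have h3 := mul_le_mul_of_nonneg_left (mul_norm_sq_le_inner_gram hm ht) hσ
    have h4 := pow_le_pow_left₀ (norm_nonneg _) (norm_gram_le hmax t) 2
    nlinarith
  rw [h1, mul_right_comm, mul_comm]
  exact (abs_real_inner_le_norm _ _).trans (mul_le_mul_of_nonneg_left h2 (norm_nonneg _))

lemma gradient_quadLoss (y : Euc m) (x : Euc n) :
    gradient (quadLoss A y) x = LinearMap.adjoint A (A x - y) := by
  refine HasGradientAt.gradient ?_
  rw [hasGradientAt_iff_hasFDerivAt]
  have h1 : HasFDerivAt (fun z => A z - y) A.toContinuousLinearMap x :=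
    (A.toContinuousLinearMap.hasFDerivAt (x := x)).sub_const y
  have h2 := (h1.norm_sq).const_mul (1 / 2 : ℝ)
  refine h2.congr_fderiv ?_
  ext v
  simp [LinearMap.adjoint_inner_left]

lemma gradient_quadLoss_sub (y : Euc m) (x z : Euc n) :
    gradient (quadLoss A y) x - gradient (quadLoss A y) z = gram A (x - z) := by
  rw [gradient_quadLoss, gradient_quadLoss, ← map_sub, sub_sub_sub_cancel_right, ← map_sub]
  rfl

end Gram

/-! ### Contraction of one Forward-Backward step -/

section Convergence

variable {n m : ℕ} {J : Euc n → EReal}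

/-- Near a manifold point, displacements along the manifold have a negligible normal component. -/
lemma IsLocalC2Equation.eventually_norm_normal_le {p : ℕ} {M : Set (Euc n)} {x : Euc n}
    {h : Euc n → Euc p} (hh : IsLocalC2Equation M x h) (hxM : x ∈ M) {δ : ℝ} (hδ : 0 < δ) :
    ∀ᶠ z in 𝓝[M] x, ∀ a ∈ (fderiv ℝ h x).ker, ∀ b ∈ ((fderiv ℝ h x).ker)ᗮ, z - x = a + b →
      ‖b‖ ≤ δ * ‖z - x‖ := by
  set T := (fderiv ℝ h x).ker
  -- The derivative of h is injective on the normal space, so it controls ‖b‖; on the manifold h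
  -- vanishes, hence this derivative at z - x is o(‖z - x‖).
  have hinj : LinearMap.ker ((fderiv ℝ h x).toLinearMap.domRestrict Tᗮ) = ⊥ := by
    rw [LinearMap.ker_eq_bot']
    intro b hb
    have hbT : (b : Euc n) ∈ T := hb
    have : (b : Euc n) ∈ T ⊓ Tᗮ := ⟨hbT, b.2⟩
    rw [Submodule.inf_orthogonal_eq_bot, Submodule.mem_bot] at this
    exact Subtype.ext this
  obtain ⟨C, hC, hanti⟩ := LinearMap.exists_antilipschitzWith _ hinj
  have hd := (hh.contDiffAt.differentiableAt (by norm_num)).hasFDerivAt.isLittleO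
  have hev := hd.bound (c := δ / C) (div_pos hδ (by exact_mod_cast hC))
  have hhx : h x = 0 := hh.mem_iff.self_of_nhds.1 hxM
  rw [eventually_nhdsWithin_iff]
  filter_upwards [hev, hh.mem_iff] with z hz hzM hzM' a ha b hb hab
  have ha' : fderiv ℝ h x a = 0 := ha
  rw [hzM.1 hzM', hhx, sub_zero, zero_sub, norm_neg] at hz
  have h1 : fderiv ℝ h x (z - x) = fderiv ℝ h x b := by rw [hab, map_add, ha', zero_add]
  rw [h1] at hz
  have h2 := hanti.le_mul_dist ⟨b, hb⟩ 0
  rw [map_zero, dist_zero_right, dist_zero_right] at h2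
  have h3 : ‖b‖ ≤ C * ‖fderiv ℝ h x b‖ := h2
  calc ‖b‖ ≤ C * (δ / C * ‖z - x‖) := h3.trans (mul_le_mul_of_nonneg_left hz C.2)
    _ = δ * ‖z - x‖ := by
      have : (C : ℝ) ≠ 0 := by exact_mod_cast hC.ne'
      field_simp

/-- A subgradient in the relative interior makes the subdifferential sharp in the normal
directions. -/
lemma mul_norm_normal_le_inner (hJ : IsProperLscConvex J) {xs us z u a b : Euc n} {ε : ℝ}
    (hε : 0 ≤ ε)
    (hball : ∀ w ∈ (modelSubspace J xs)ᗮ, ‖w‖ ≤ ε → us + w ∈ subdiff J xs)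
    (hu : u ∈ subdiff J z) (ha : a ∈ modelSubspace J xs) (hb : b ∈ (modelSubspace J xs)ᗮ)
    (hab : z - xs = a + b) : ε * ‖b‖ ≤ inner ℝ (u - us) (z - xs) := by
  -- For b = 0 the quotient ε / 0 is 0 and the tilt disappears.
  have hw : ‖(ε / ‖b‖) • b‖ ≤ ε := by
    rw [norm_smul, Real.norm_of_nonneg (by positivity)]
    rcases eq_or_ne ‖b‖ 0 with h | h
    · simpa [h] using hε
    · rw [div_mul_cancel₀ _ h]
  have h1 := hJ.subdiff_monotone hu (hball _ (Submodule.smul_mem _ _ hb) hw)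
  have h2 : (inner ℝ ((ε / ‖b‖) • b) (z - xs) : ℝ) = ε * ‖b‖ := by
    rw [hab, inner_add_right, inner_smul_left, inner_smul_left,
      Submodule.inner_left_of_mem_orthogonal ha hb, real_inner_self_eq_norm_sq]
    rcases eq_or_ne ‖b‖ 0 with h | h
    · simp [h]
    · simp only [conj_trivial]; field_simp; ring
  rw [← sub_sub, inner_sub_left, h2] at h1
  linarith

lemma norm_le_norm_add_of_mem_orthogonal {T : Submodule ℝ (Euc n)} {a b : Euc n} (ha : a ∈ T)
    (hb : b ∈ Tᗮ) : ‖a‖ ≤ ‖a + b‖ := by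
  refine le_of_sq_le_sq ?_ (norm_nonneg _)
  rw [norm_add_sq_real, Submodule.inner_right_of_mem_orthogonal ha hb]
  linarith [sq_nonneg ‖b‖]

/-- One Forward-Backward step contracts at the linear rate, up to the normal component of the
current displacement. -/
lemma norm_forwardBackward_step_le (hJ : IsProperLscConvex J) {A : Euc n →ₗ[ℝ] Euc m} {y : Euc m}
    {xs : Euc n} {σmax σm σM : ℝ}
    (hσmax : IsGreatest (eigenvalueSet (gram A)) σmax)
    (hσm : IsLeast (eigenvalueSet (gramOn A (modelSubspace J xs))) σm)
    (hσM : IsGreatest (eigenvalueSet (gramOn A (modelSubspace J xs))) σM)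
    {ε g : ℝ} (hε : 0 ≤ ε) (hg : 0 < g)
    (hball : ∀ w ∈ (modelSubspace J xs)ᗮ, ‖w‖ ≤ ε →
      -gradient (quadLoss A y) xs + w ∈ subdiff J xs)
    {x z : Euc n} (hz : IsProx g J (x - g • gradient (quadLoss A y) x) z)
    (hsmall : ‖(x - xs) - g • gram A (x - xs)‖ ≤ g * ε)
    {a b : Euc n} (ha : a ∈ modelSubspace J xs) (hb : b ∈ (modelSubspace J xs)ᗮ)
    (hab : x - xs = a + b) :
    ‖z - xs‖ ≤ linRate σm σM g * ‖a‖ + g * √(2 * σmax * (σmax - σm)) * ‖b‖ := by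
  obtain ⟨a', ha', b', hb', hab'⟩ :=
    (modelSubspace J xs).exists_add_mem_mem_orthogonal (z - xs)
  set C := √(2 * σmax * (σmax - σm)) with hC
  set w := (x - xs) - g • gram A (x - xs) with hw
  have h1 := mul_norm_normal_le_inner hJ hε hball (hz.mem_subdiff hJ hg) ha' hb' hab'
  have h2 : g • (g⁻¹ • (x - g • gradient (quadLoss A y) x - z) - -gradient (quadLoss A y) xs) =
      w - (z - xs) := by
    rw [hw, ← gradient_quadLoss_sub y, smul_sub, smul_inv_smul₀ hg.ne']
    module
  have h3 : g * (ε * ‖b'‖) ≤ inner ℝ w (z - xs) - ‖z - xs‖ ^ 2 := by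
    rw [← real_inner_self_eq_norm_sq, ← inner_sub_left, ← h2, inner_smul_left]
    exact mul_le_mul_of_nonneg_left h1 hg.le
  have h4 : (inner ℝ w (z - xs) : ℝ) = inner ℝ w a' + inner ℝ w b' := by
    rw [hab', inner_add_right]
  have h5 : (inner ℝ w b' : ℝ) ≤ g * ε * ‖b'‖ :=
    (real_inner_le_norm _ _).trans (mul_le_mul_of_nonneg_right hsmall (norm_nonneg _))
  have h6 : (inner ℝ w a' : ℝ) ≤ (linRate σm σM g * ‖a‖ + g * C * ‖b‖) * ‖a'‖ := by
    have e : w = (a - g • gram A a) + b - g • gram A b := by rw [hw, hab, map_add]; module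
    rw [e, inner_sub_left, inner_add_left, Submodule.inner_left_of_mem_orthogonal ha' hb,
      inner_smul_left]
    have h7 := inner_sub_smul_gram_le hg.le hσm hσM ha ha'
    have h8 := mul_le_mul_of_nonneg_left
      (neg_le_of_abs_le (abs_inner_gram_orthogonal_le hσmax hσm hb ha')) hg.le
    rw [← hC] at h8
    simp only [conj_trivial]
    linarith
  have h9 : ‖a'‖ ≤ ‖z - xs‖ := by
    rw [hab']; exact norm_le_norm_add_of_mem_orthogonal ha' hb'
  have hnn : 0 ≤ linRate σm σM g * ‖a‖ + g * C * ‖b‖ := by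
    have := linRate_nonneg σm σM g
    positivity
  have h10 := mul_le_mul_of_nonneg_left h9 hnn
  -- The terms gε‖b'‖ in `h3` and `h5` cancel, so ‖z - xs‖² is at most the bound in `h6`; one factor
  -- is then divided out.
  rcases (norm_nonneg (z - xs)).eq_or_lt with h0 | h0
  · rwa [← h0]
  · refine le_of_mul_le_mul_right ?_ h0
    nlinarith

end Convergence

/-! ### Identification along the iterates -/

section Convergence

variable {n m : ℕ} {J : Euc n → EReal}

/-- Finite identification of the active manifold by the Forward-Backward iterates. -/
lemma IsForwardBackward.eventually_mem (hJ : IsProperLscConvex J) {A : Euc n →ₗ[ℝ] Euc m}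
    {y : Euc m} {xs : Euc n} {M : Set (Euc n)} (hM : IsPartlySmoothAt J xs M)
    (hnd : -gradient (quadLoss A y) xs ∈ intrinsicInterior ℝ (subdiff J xs))
    {γlo : ℝ} {γ : ℕ → ℝ} (hlo : 0 < γlo) (hγ : ∀ k, γlo ≤ γ k) {x : ℕ → Euc n}
    (hx : IsForwardBackward (quadLoss A y) J γ x) (hlim : Tendsto x atTop (𝓝 xs)) :
    ∀ᶠ k in atTop, x k ∈ M := by
  have hγpos : ∀ k, 0 < γ k := fun k => hlo.trans_le (hγ k)
  have hlim' : Tendsto (fun k => x (k + 1)) atTop (𝓝 xs) := (tendsto_add_atTop_iff_nat 1).2 hlim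
  have hgrad : Continuous (gradient (quadLoss A y)) := by
    have : gradient (quadLoss A y) = fun z => LinearMap.adjoint A (A z - y) :=
      funext (gradient_quadLoss y)
    rw [this]
    exact (LinearMap.adjoint A).continuous_of_finiteDimensional.comp
      (A.continuous_of_finiteDimensional.sub continuous_const)
  -- The lower bound on the step sizes keeps the factors 1/γ k bounded.
  have hstep : Tendsto (fun k => (γ k)⁻¹ • (x k - x (k + 1))) atTop (𝓝 0) := by
    refine squeeze_zero_norm (a := fun k => γlo⁻¹ * ‖x k - x (k + 1)‖) (fun k => ?_) ?_
    · rw [norm_smul, Real.norm_of_nonneg (inv_pos.2 (hγpos k)).le]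
      exact mul_le_mul_of_nonneg_right (inv_anti₀ hlo (hγ k)) (norm_nonneg _)
    · simpa using ((hlim.sub hlim').norm).const_mul γlo⁻¹
  have hu : Tendsto (fun k => (γ k)⁻¹ • (x k - γ k • gradient (quadLoss A y) (x k) - x (k + 1)))
      atTop (𝓝 (-gradient (quadLoss A y) xs)) := by
    have := hstep.sub ((hgrad.tendsto xs).comp hlim)
    rw [zero_sub] at this
    refine this.congr fun k => ?_
    rw [Function.comp_apply, sub_right_comm, smul_sub _ (x k - x (k + 1)),
      inv_smul_smul₀ (hγpos k).ne']
  -- The subgradient produced at step k lives at x (k + 1), hence the index shift afterwards.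
  have := hM.eventually_mem hJ hnd hlim' hu
    (Eventually.of_forall fun k => (hx k).mem_subdiff hJ (hγpos k))
  rw [eventually_atTop] at this ⊢
  obtain ⟨K, hK⟩ := this
  refine ⟨K + 1, fun k hk => ?_⟩
  obtain ⟨j, rfl⟩ := Nat.exists_eq_add_of_le' hk
  exact hK (j + K) (by omega)

end Convergence

/-! ### Assembly of the theorem -/

theorem mainTheorem3 {n m : ℕ} (A : Euc n →ₗ[ℝ] Euc m) (y : Euc m)
    (J : Euc n → EReal) (hJ : IsProperLscConvex J)
    (xs : Euc n)
    (hxs : IsMinOn (fun z => (quadLoss A y z : EReal) + J z) univ xs)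
    (M : Set (Euc n)) (hM : IsPartlySmoothAt J xs M)
    (hnd : -gradient (quadLoss A y) xs ∈ intrinsicInterior ℝ (subdiff J xs))
    (hT : modelSubspace J xs ≠ ⊥)
    (hker : LinearMap.ker A ⊓ modelSubspace J xs = ⊥)
    (σmax σm σM : ℝ)
    (hσmax : IsGreatest (eigenvalueSet (gram A)) σmax)
    (hσm : IsLeast (eigenvalueSet (gramOn A (modelSubspace J xs))) σm)
    (hσM : IsGreatest (eigenvalueSet (gramOn A (modelSubspace J xs))) σM)
    (γlo γhi : ℝ) (γ : ℕ → ℝ) (hlo : 0 < γlo) (hγ : ∀ k, γlo ≤ γ k ∧ γ k ≤ γhi)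
    (hhi : γhi < 2 / σmax)
    (x : ℕ → Euc n) (hx : IsForwardBackward (quadLoss A y) J γ x)
    (hlim : Tendsto x atTop (𝓝 xs)) :
    ∃ K : ℕ, 0 < K ∧
      -- the `Q`-linear rate
      (γhi < 2 * σm / σmax ^ 2 →
        max (qRate σm σmax γlo) (qRate σm σmax γhi) ∈ Ico (0 : ℝ) 1 ∧
        ∀ k ≥ K, ∀ ρ : ℝ, √(max (qRate σm σmax γlo) (qRate σm σmax γhi)) < ρ → ρ < 1 →
          ‖x (k + 1) - xs‖ ≤ ρ * ‖x k - xs‖) ∧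
      -- the rate for affine or linear manifolds, and its optimal value
      (IsPartlySmoothAffine J xs ∨ IsPartlySmoothLinear J xs →
        (∀ k ≥ K, linRate σm σM (γ k) ∈ Ico (0 : ℝ) 1 ∧
          ‖x (k + 1) - xs‖ ≤ linRate σm σM (γ k) * ‖x k - xs‖) ∧
        (2 / (σm + σM) ≤ γhi →
          (∀ g : ℝ, linRate σm σM (2 / (σm + σM)) ≤ linRate σm σM g) ∧
          linRate σm σM (2 / (σm + σM)) = (σM / σm - 1) / (σM / σm + 1) ∧
          (σM / σm - 1) / (σM / σm + 1) = 1 - 2 / (σM / σm + 1) ∧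
          ((∀ k, γ k = 2 / (σm + σM)) → ∀ k ≥ K,
            ‖x (k + 1) - xs‖ ≤ (σM / σm - 1) / (σM / σm + 1) * ‖x k - xs‖))) := by
  have hσmpos : 0 < σm := pos_of_mem_eigenvalueSet_gramOn hker hσm.1
  have hmM : σm ≤ σM := hσm.2 hσM.1
  have hMmax : σM ≤ σmax := le_of_mem_eigenvalueSet_gramOn hσmax hσM.1
  have hmaxpos : 0 < σmax := hσmpos.trans_le (hmM.trans hMmax)
  have hγpos : ∀ k, 0 < γ k := fun k => hlo.trans_le (hγ k).1
  have hlohi : γlo ≤ γhi := (hγ 0).1.trans (hγ 0).2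
  obtain ⟨ε, hε, hball⟩ := exists_pos_forall_add_mem_subdiff hnd
  obtain ⟨δ, hδ, hrate⟩ := exists_pos_linRate_add_le_sqrt (hi := γhi) hσmpos hmM hMmax hlo
  have hident : ∀ M', IsPartlySmoothAt J xs M' → ∀ᶠ k in atTop, x k ∈ M' := fun M' hM' =>
    IsForwardBackward.eventually_mem hJ hM' hnd hlo (fun k => (hγ k).1) hx hlim
  -- Convergence to xs makes the forward displacement fit within the ball of normal tilts, scaled by
  -- γ k.
  have hsmall : ∀ᶠ k in atTop, ‖(x k - xs) - γ k • gram A (x k - xs)‖ ≤ γ k * ε := by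
    have hlim0 : Tendsto (fun k => (1 + γhi * σmax) * ‖x k - xs‖) atTop (𝓝 0) := by
      simpa using (tendsto_iff_norm_sub_tendsto_zero.1 hlim).const_mul (1 + γhi * σmax)
    filter_upwards [hlim0.eventually_lt_const (mul_pos hlo hε)] with k hk
    calc _ ≤ ‖x k - xs‖ + γ k * ‖gram A (x k - xs)‖ := by
          refine (norm_sub_le _ _).trans_eq ?_
          rw [norm_smul, Real.norm_of_nonneg (hγpos k).le]
      _ ≤ ‖x k - xs‖ + γhi * (σmax * ‖x k - xs‖) := by
          gcongr
          · exact hlo.le.trans hlohi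
          · exact (hγ k).2
          · exact norm_gram_le hσmax _
      _ ≤ γ k * ε := by
          have := mul_le_mul_of_nonneg_right (hγ k).1 hε.le
          linarith
  have hnormal : ∀ᶠ k in atTop, ∀ a ∈ modelSubspace J xs, ∀ b ∈ (modelSubspace J xs)ᗮ,
      x k - xs = a + b → ‖b‖ ≤ δ * ‖x k - xs‖ := by
    obtain ⟨p, h, hh, hkerh⟩ := hM.smooth_sharp
    have := (tendsto_nhdsWithin_iff.2 ⟨hlim, hident M hM⟩).eventually
      (hh.eventually_norm_normal_le hM.mem hδ)
    rwa [hkerh] at this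
  have htan : ∀ᶠ k in atTop, IsPartlySmoothAffine J xs ∨ IsPartlySmoothLinear J xs →
      x k - xs ∈ modelSubspace J xs := by
    by_cases hps : IsPartlySmoothAffine J xs ∨ IsPartlySmoothLinear J xs
    · rcases hps with hps | hps
      · filter_upwards [hident _ hps] with k hk _
        simpa [AffineSubspace.mem_mk'] using hk
      · filter_upwards [hident _ hps] with k hk _
        exact Submodule.sub_mem _ hk hps.mem
    · exact Eventually.of_forall fun k h => absurd h hps
  obtain ⟨K, hK⟩ := eventually_atTop.1 (hsmall.and (hnormal.and htan))
  have hlin : IsPartlySmoothAffine J xs ∨ IsPartlySmoothLinear J xs → ∀ k ≥ K + 1,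
      ‖x (k + 1) - xs‖ ≤ linRate σm σM (γ k) * ‖x k - xs‖ := fun hps k hk => by
    obtain ⟨h1, -, h3⟩ := hK k (by omega)
    -- The displacement is purely tangential, so the step bound applies with b = 0.
    simpa using norm_forwardBackward_step_le hJ hσmax hσm hσM hε.le (hγpos k) hball (hx k) h1
      (h3 hps) (Submodule.zero_mem _) (add_zero _).symm
  refine ⟨K + 1, K.succ_pos, fun hhi' => ⟨⟨?_, ?_⟩, fun k hk ρ hρ _ => ?_⟩,
    fun hps => ⟨fun k hk => ⟨⟨linRate_nonneg _ _ _, ?_⟩, hlin hps k hk⟩,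
      fun _ => ⟨linRate_optimal_le hσmpos hmM, ?_, ?_, fun hγk k hk => ?_⟩⟩⟩
  · exact le_max_of_le_left (qRate_nonneg hσmpos.le (hmM.trans hMmax))
  · exact max_lt (qRate_lt_one hlo hmaxpos (hlohi.trans_lt hhi'))
      (qRate_lt_one (hlo.trans_le hlohi) hmaxpos hhi')
  · obtain ⟨h1, h2, -⟩ := hK k (by omega)
    obtain ⟨a, ha, b, hb, hab⟩ := (modelSubspace J xs).exists_add_mem_mem_orthogonal (x k - xs)
    refine (norm_forwardBackward_step_le hJ hσmax hσm hσM hε.le (hγpos k) hball (hx k) h1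
      ha hb hab).trans ?_
    have hak : ‖a‖ ≤ ‖x k - xs‖ := by
      rw [hab]; exact norm_le_norm_add_of_mem_orthogonal ha hb
    calc _ ≤ linRate σm σM (γ k) * ‖x k - xs‖ +
          γ k * √(2 * σmax * (σmax - σm)) * (δ * ‖x k - xs‖) := by
          have := linRate_nonneg σm σM (γ k)
          have := (hγpos k).le
          gcongr
          exact h2 a ha b hb hab
      _ = (linRate σm σM (γ k) + γ k * √(2 * σmax * (σmax - σm)) * δ) * ‖x k - xs‖ := by ring
      _ ≤ ρ * ‖x k - xs‖ := by
          gcongr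
          exact (hrate _ (hγ k).1 (hγ k).2).trans hρ.le
  · refine linRate_lt_one (hγpos k) hσmpos hmM ?_
    have h1 : γ k * σmax < 2 := (lt_div_iff₀ hmaxpos).1 ((hγ k).2.trans_lt hhi)
    exact (mul_le_mul_of_nonneg_left hMmax (hγpos k).le).trans_lt h1
  · exact linRate_optimal_eq hσmpos hmM
  · have : σM / σm + 1 ≠ 0 := by have := div_pos (hσmpos.trans_le hmM) hσmpos; linarith
    rw [eq_sub_iff_add_eq, ← add_div, div_eq_one_iff_eq this]
    ring
  · rw [← linRate_optimal_eq hσmpos hmM, ← hγk k]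
    exact hlin hps k hk
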